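/- Conventions. Let $\mathcal B$ be a bicategory with adjoints: every 1-morphism $X\in\mathcal B(a,b)$ has a chosen left adjoint ${}^\dagger X\in\mathcal B(b,a)$, with adjunction maps $\mathrm{ev}_X:{}^\dagger X\otimes X\to I_a$, $\mathrm{coev}_X:I_b\to X\otimes{}^\dagger X$, and a chosen right adjoint $X^\dagger\in\mathcal B(b,a)$, with adjunction maps $\widetilde{\mathrm{ev}}_X:X\otimes X^\dagger\to I_b$, $\widetilde{\mathrm{coev}}_X:I_a\to X^\dagger\otimes X$. For $\alpha:{}^\dagger X\to X^\dagger$ put $\mathrm{tr}_{\mathrm r}(\alpha)=\widetilde{\mathrm{ev}}_X\circ(1_X\otimes\alpha)\circ\mathrm{coev}_X\in\mathrm{End}(I_b)$. A Frobenius algebra is a 1-morphism $A\in\mathcal B(a,a)$ with an algebra structure $(\mu,\eta)$ and a coalgebra structure $(\Delta,\varepsilon)$ such that $(1\otimes\mu)\circ(\Delta\otimes1)=\Delta\circ\mu=(\mu\otimes1)\circ(1\otimes\Delta)$; it is separable if $\mu\circ\Delta=1_A$. For an algebra $A$, a right $A$-module $M$ and a left $A$-module $N$, $M\otimes_AN$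 is the coequaliser of the two maps $M\otimes A\otimes N\to M\otimes N$ given by the actions. If all categories $\mathcal B(c,d)$ are idempotent complete, the equivariant completion $\mathcal B_{\mathrm{eq}}$ is the bicategory whose objects are pairs $(a,A)$ of an object $a$ and a separable Frobenius algebra $A\in\mathcal B(a,a)$, whose 1-morphisms $(a,A)\to(b,B)$ are $B$-$A$-bimodules in $\mathcal B(a,b)$, whose 2-morphisms are bimodule maps, whose horizontal composition is the tensor product over the intermediate algebra, and in which the identity of $(a,A)$ is $A$. Below, $\cong$ between objects of $\mathcal B_{\mathrm{eq}}$ means equivalence in this bicategory. Proposition. Let $\mathcal B$ be a bicategory with adjoints, $X\in\mathcal B(a,b)$, let $\alpha:{}^\dagger X\to X^\dagger$ be an isomorphism, and set $\mathcal A=X^\dagger\otimes X\in\mathcal B(a,a)$. (i) $\mathcal A$ is a Frobenius algebra, with multiplication $1_{X^\dagger}\otimes\widetilde{\mathrm{ev}}_X\otimes1_X$, unit $\widetilde{\mathrm{coev}}_X$, comultiplication $1_{X^\dagger}\otimes\big((1_X\otimes\alpha)\circ\mathrm{coev}_X\big)\otimes1_X$ and counit $\mathrm{ev}_X\circ(\alpha^{-1}\otimes1_X)$.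 If $\mathrm{tr}_{\mathrm r}(\alpha)$ is invertible, then $\mathcal A$, with the same multiplication and unit, the comultiplication $1_{X^\dagger}\otimes\big((1_X\otimes\alpha)\circ\mathrm{coev}_X\circ\mathrm{tr}_{\mathrm r}(\alpha)^{-1}\big)\otimes1_X$ and the counit $\mathrm{ev}_X\circ(\alpha^{-1}\otimes1_X)\circ(1_{X^\dagger}\otimes\mathrm{tr}_{\mathrm r}(\alpha)\otimes1_X)$, is a separable Frobenius algebra. (ii) Suppose that $\mathrm{tr}_{\mathrm r}(\alpha)$ is invertible. Then $X\otimes_{\mathcal A}X^\dagger$ (for the actions $\widetilde{\mathrm{ev}}_X\otimes1_X$ of $\mathcal A$ on $X$ and $1_{X^\dagger}\otimes\widetilde{\mathrm{ev}}_X$ of $\mathcal A$ on $X^\dagger$) exists and $X\otimes_{\mathcal A}X^\dagger\cong I_b$; more precisely, $\widetilde{\mathrm{ev}}_X:X\otimes X^\dagger\to I_b$ is the coequaliser. If moreover all categories $\mathcal B(c,d)$ are idempotent complete, then $(a,\mathcal A)\cong(b,I_b)$ in $\mathcal B_{\mathrm{eq}}$, where $\mathcal A$ carries the separable Frobenius structure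 of (i) and $I_b$ the trivial one. -/

import Mathlib

open CategoryTheory Bicategory Limits

universe w v u

namespace Orbifold

variable {B : Type u} [Bicategory.{w, v} B]

/-- A Frobenius algebra structure on a 1-endomorphism `A`: an algebra and a coalgebra structure
satisfying the two Frobenius relations. In diagrammatic notation `f ≫ g` stands for `g ⊗ f`. -/
structure FrobeniusAlgebra {a : B} (A : a ⟶ a) where
  mul : A ≫ A ⟶ A
  one : 𝟙 a ⟶ A
  comul : A ⟶ A ≫ A
  counit : A ⟶ 𝟙 a
  one_mul : one ▷ A ≫ mul = (λ_ A).hom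
  mul_one : A ◁ one ≫ mul = (ρ_ A).hom
  mul_assoc : mul ▷ A ≫ mul = (α_ A A A).hom ≫ A ◁ mul ≫ mul
  counit_comul : comul ≫ counit ▷ A = (λ_ A).inv
  comul_counit : comul ≫ A ◁ counit = (ρ_ A).inv
  comul_assoc : comul ≫ comul ▷ A ≫ (α_ A A A).hom = comul ≫ A ◁ comul
  frobenius_left : comul ▷ A ≫ (α_ A A A).hom ≫ A ◁ mul = mul ≫ comul
  frobenius_right : A ◁ comul ≫ (α_ A A A).inv ≫ mul ▷ A = mul ≫ comul

/-- A Frobenius algebra is separable if multiplication after comultiplication is the identity. -/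
def FrobeniusAlgebra.IsSeparable {a : B} {A : a ⟶ a} (F : FrobeniusAlgebra A) : Prop :=
  F.comul ≫ F.mul = 𝟙 A

variable (B) in
/-- Objects of the equivariant completion of `B`: pairs of an object of `B` and a separable
Frobenius algebra on it. The bicategory structure, with bimodules as 1-morphisms, is the instance
below. -/
structure EquivariantCompletion where
  base : B
  alg : base ⟶ base
  frob : FrobeniusAlgebra alg
  separable : frob.IsSeparable

/-- 1-morphisms of the equivariant completion: bimodules. The algebra `P.alg` of the source acts on
`X : P.base ⟶ Q.base` by `l`, and the algebra `Q.alg` of the target acts by `r` (in the tensor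
notation, where `f ≫ g` is `g ⊗ f`, these are the right and the left action, respectively). -/
structure Bimodule (P Q : EquivariantCompletion B) where
  X : P.base ⟶ Q.base
  l : P.alg ≫ X ⟶ X
  r : X ≫ Q.alg ⟶ X
  one_l : P.frob.one ▷ X ≫ l = (λ_ X).hom
  mul_l : P.frob.mul ▷ X ≫ l = (α_ P.alg P.alg X).hom ≫ P.alg ◁ l ≫ l
  r_one : X ◁ Q.frob.one ≫ r = (ρ_ X).hom
  r_mul : X ◁ Q.frob.mul ≫ r = (α_ X Q.alg Q.alg).inv ≫ r ▷ Q.alg ≫ r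
  middle : l ▷ Q.alg ≫ r = (α_ P.alg X Q.alg).hom ≫ P.alg ◁ r ≫ l

/-- 2-morphisms of the equivariant completion: bimodule maps. -/
@[ext]
structure Bimodule.Hom {P Q : EquivariantCompletion B} (M N : Bimodule P Q) where
  hom : M.X ⟶ N.X
  l_comm : M.l ≫ hom = P.alg ◁ hom ≫ N.l
  r_comm : M.r ≫ hom = hom ▷ Q.alg ≫ N.r

instance (P Q : EquivariantCompletion B) : Category (Bimodule P Q) where
  Hom M N := Bimodule.Hom M N
  id M := ⟨𝟙 _, by simp, by simp⟩
  comp f g := ⟨f.hom ≫ g.hom,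
    by rw [← Category.assoc, f.l_comm, Category.assoc, g.l_comm, whiskerLeft_comp, Category.assoc],
    by rw [← Category.assoc, f.r_comm, Category.assoc, g.r_comm, comp_whiskerRight, Category.assoc]⟩
  id_comp f := Bimodule.Hom.ext (Category.id_comp _)
  comp_id f := Bimodule.Hom.ext (Category.comp_id _)
  assoc f g h := Bimodule.Hom.ext (Category.assoc _ _ _)

namespace Bimodule

@[ext]
theorem hom_ext {P Q : EquivariantCompletion B} {M N : Bimodule P Q} {f g : M ⟶ N} (h : f.hom = g.hom) : f = g :=
  Bimodule.Hom.ext h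

@[simp] theorem id_hom {P Q : EquivariantCompletion B} (M : Bimodule P Q) : Bimodule.Hom.hom (𝟙 M) = 𝟙 M.X := rfl

@[simp] theorem comp_hom {P Q : EquivariantCompletion B} {M N K : Bimodule P Q} (f : M ⟶ N) (g : N ⟶ K) :
    (f ≫ g).hom = f.hom ≫ g.hom := rfl

/-- A bimodule map that is invertible in the underlying category is an isomorphism. -/
def isoMk {P Q : EquivariantCompletion B} {M N : Bimodule P Q} (e : M.X ≅ N.X)
    (hl : M.l ≫ e.hom = P.alg ◁ e.hom ≫ N.l) (hr : M.r ≫ e.hom = e.hom ▷ Q.alg ≫ N.r) :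
    M ≅ N where
  hom := ⟨e.hom, hl, hr⟩
  inv := ⟨e.inv, by rw [Iso.comp_inv_eq, Category.assoc, hl, ← whiskerLeft_comp_assoc]; simp,
    by rw [Iso.comp_inv_eq, Category.assoc, hr, ← comp_whiskerRight_assoc]; simp⟩
  hom_inv_id := hom_ext (by simp)
  inv_hom_id := hom_ext (by simp)

end Bimodule

instance isSplitEpi_whiskerLeft {a b c : B} (W : a ⟶ b) {f g : b ⟶ c} (h : f ⟶ g)
    [IsSplitEpi h] : IsSplitEpi (W ◁ h) :=
  IsSplitEpi.mk' ⟨W ◁ section_ h, by rw [← whiskerLeft_comp, IsSplitEpi.id, whiskerLeft_id]⟩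

instance isSplitEpi_whiskerRight {a b c : B} {f g : a ⟶ b} (h : f ⟶ g) (W : b ⟶ c)
    [IsSplitEpi h] : IsSplitEpi (h ▷ W) :=
  IsSplitEpi.mk' ⟨section_ h ▷ W, by rw [← comp_whiskerRight, IsSplitEpi.id, id_whiskerRight]⟩


/-- For a module `M` with action `r` and a module `N` with action `l` over an algebra `A`,
`IsRelativeTensor r l p` says that `p : M ≫ N ⟶ T` exhibits `T` as the tensor product over `A`,
that is, as the coequalizer of the two maps `M ≫ A ≫ N ⟶ M ≫ N` given by the actions. -/
def IsRelativeTensor {a b c : B} {A : b ⟶ b} {M : a ⟶ b} {N : b ⟶ c} (r : M ≫ A ⟶ M)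
    (l : A ≫ N ⟶ N) {T : a ⟶ c} (p : M ≫ N ⟶ T) : Prop :=
  ∃ h : r ▷ N ≫ p = ((α_ M A N).hom ≫ M ◁ l) ≫ p,
    Nonempty (IsColimit (Cofork.ofπ (f := r ▷ N) (g := (α_ M A N).hom ≫ M ◁ l) p h))

variable {P Q R S T : EquivariantCompletion B}

theorem EquivariantCompletion.one_comul_left (P : EquivariantCompletion B) :
    P.frob.comul = (ρ_ _).inv ≫ P.alg ◁ (P.frob.one ≫ P.frob.comul) ≫
      (α_ _ _ _).inv ≫ P.frob.mul ▷ P.alg := by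
  rw [whiskerLeft_comp, Category.assoc, P.frob.frobenius_right, reassoc_of% P.frob.mul_one]
  simp

theorem EquivariantCompletion.one_comul_right (P : EquivariantCompletion B) :
    P.frob.comul = (λ_ _).inv ≫ (P.frob.one ≫ P.frob.comul) ▷ P.alg ≫
      (α_ _ _ _).hom ≫ P.alg ◁ P.frob.mul := by
  rw [comp_whiskerRight, Category.assoc, P.frob.frobenius_left, reassoc_of% P.frob.one_mul]
  simp

namespace Bimodule

/-- The canonical linear section of the action map of a bimodule over a separable Frobenius
algebra. -/
def sec (N : Bimodule Q R) : N.X ⟶ Q.alg ≫ N.X :=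
  (λ_ N.X).inv ≫ (Q.frob.one ≫ Q.frob.comul) ▷ N.X ≫ (α_ _ _ _).hom ≫ Q.alg ◁ N.l

theorem sec_l (N : Bimodule Q R) : N.sec ≫ N.l = 𝟙 _ := by
  have h := Q.separable
  unfold FrobeniusAlgebra.IsSeparable at h
  simp only [sec, Category.assoc]
  rw [← N.mul_l, ← comp_whiskerRight_assoc, Category.assoc, h, Category.comp_id, N.one_l]
  simp

theorem l_sec (N : Bimodule Q R) :
    N.l ≫ N.sec = Q.alg ◁ N.sec ≫ (α_ _ _ _).inv ≫ Q.frob.mul ▷ N.X := by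
  have h1 : N.l ≫ N.sec = Q.frob.comul ▷ N.X ≫ (α_ _ _ _).hom ≫ Q.alg ◁ N.l := by
    conv_rhs => rw [Q.one_comul_right]
    simp only [sec]
    set δ := Q.frob.one ≫ Q.frob.comul
    calc _ = 𝟙 _ ⊗≫ ((𝟙 _) ◁ N.l ≫ δ ▷ N.X) ⊗≫ Q.alg ◁ N.l := by bicategory
      _ = 𝟙 _ ⊗≫ δ ▷ (Q.alg ≫ N.X) ⊗≫ Q.alg ◁ ((α_ _ _ _).hom ≫ Q.alg ◁ N.l ≫ N.l) := by
        rw [whisker_exchange]; bicategory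
      _ = _ := by
        rw [← N.mul_l]; bicategory
  rw [h1, Q.one_comul_left]
  simp only [sec]
  set δ := Q.frob.one ≫ Q.frob.comul
  calc _ = 𝟙 _ ⊗≫ Q.alg ◁ δ ▷ N.X ⊗≫ (Q.frob.mul ▷ (Q.alg ≫ N.X) ≫ Q.alg ◁ N.l) := by bicategory
    _ = _ := by rw [← whisker_exchange]; bicategory

theorem sec_natural {N N' : Bimodule Q R} (g : N ⟶ N') :
    g.hom ≫ N'.sec = N.sec ≫ Q.alg ◁ g.hom := by
  simp only [sec, Category.assoc]
  set δ := Q.frob.one ≫ Q.frob.comul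
  rw [← whiskerLeft_comp, g.l_comm]
  calc _ = 𝟙 _ ⊗≫ (𝟙 _ ◁ g.hom ≫ δ ▷ N'.X) ⊗≫ Q.alg ◁ N'.l := by bicategory
    _ = _ := by rw [whisker_exchange]; bicategory

theorem sec_r (N : Bimodule Q R) :
    N.r ≫ N.sec = N.sec ▷ R.alg ≫ (α_ _ _ _).hom ≫ Q.alg ◁ N.r := by
  simp only [sec]
  set δ := Q.frob.one ≫ Q.frob.comul
  calc _ = 𝟙 _ ⊗≫ (𝟙 _ ◁ N.r ≫ δ ▷ N.X) ⊗≫ Q.alg ◁ N.l := by bicategory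
    _ = 𝟙 _ ⊗≫ δ ▷ (N.X ≫ R.alg) ⊗≫ Q.alg ◁ ((α_ _ _ _).hom ≫ Q.alg ◁ N.r ≫ N.l) := by
      rw [whisker_exchange]; bicategory
    _ = _ := by rw [← N.middle]; bicategory

/-- Maps out of `M ≫ N` that coequalize the two actions of the intermediate algebra. -/
def Balanced (M : Bimodule P Q) (N : Bimodule Q R) {Z : P.base ⟶ R.base} (h : M.X ≫ N.X ⟶ Z) : Prop :=
  M.r ▷ N.X ≫ h = (α_ _ _ _).hom ≫ M.X ◁ N.l ≫ h

/-- The idempotent on `M ≫ N` whose image is the tensor product over the intermediate algebra. -/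
def idem (M : Bimodule P Q) (N : Bimodule Q R) : M.X ≫ N.X ⟶ M.X ≫ N.X :=
  M.X ◁ N.sec ≫ (α_ _ _ _).inv ≫ M.r ▷ N.X

theorem idem_comp (M : Bimodule P Q) (N : Bimodule Q R) {Z : P.base ⟶ R.base} (h : M.X ≫ N.X ⟶ Z)
    (hh : Balanced M N h) : idem M N ≫ h = h := by
  unfold Balanced at hh
  simp only [idem, Category.assoc, hh]
  simp only [Iso.inv_hom_id_assoc, ← whiskerLeft_comp_assoc, sec_l]
  simp

theorem idem_balanced (M : Bimodule P Q) (N : Bimodule Q R) : Balanced M N (idem M N) := by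
  unfold Balanced
  simp only [idem]
  rw [← whiskerLeft_comp_assoc, l_sec]
  calc _ = (M.r ▷ N.X ≫ M.X ◁ N.sec) ⊗≫ M.r ▷ N.X := by bicategory
    _ = (M.X ≫ Q.alg) ◁ N.sec ⊗≫ ((α_ _ _ _).inv ≫ M.r ▷ Q.alg ≫ M.r) ▷ N.X := by
      rw [← whisker_exchange]; bicategory
    _ = _ := by rw [← M.r_mul]; bicategory

theorem idem_idem (M : Bimodule P Q) (N : Bimodule Q R) : idem M N ≫ idem M N = idem M N :=
  idem_comp M N _ (idem_balanced M N)

section tensor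

variable [∀ a b : B, IsIdempotentComplete (a ⟶ b)]

/-- The image of the idempotent `idem M N`. -/
noncomputable def tensorX (M : Bimodule P Q) (N : Bimodule Q R) : P.base ⟶ R.base :=
  (IsIdempotentComplete.idempotents_split _ (idem M N) (idem_idem M N)).choose

/-- The inclusion of the image. -/
noncomputable def ι (M : Bimodule P Q) (N : Bimodule Q R) : tensorX M N ⟶ M.X ≫ N.X :=
  (IsIdempotentComplete.idempotents_split _ (idem M N) (idem_idem M N)).choose_spec.choose

/-- The projection onto the image. -/
noncomputable def π (M : Bimodule P Q) (N : Bimodule Q R) : M.X ≫ N.X ⟶ tensorX M N :=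
  (IsIdempotentComplete.idempotents_split _ (idem M N) (idem_idem M N)).choose_spec.choose_spec.choose

@[simp]
theorem ι_π (M : Bimodule P Q) (N : Bimodule Q R) : ι M N ≫ π M N = 𝟙 _ :=
  (IsIdempotentComplete.idempotents_split _ (idem M N)
    (idem_idem M N)).choose_spec.choose_spec.choose_spec.1

theorem π_ι (M : Bimodule P Q) (N : Bimodule Q R) : π M N ≫ ι M N = idem M N :=
  (IsIdempotentComplete.idempotents_split _ (idem M N)
    (idem_idem M N)).choose_spec.choose_spec.choose_spec.2

instance isSplitEpi_π (M : Bimodule P Q) (N : Bimodule Q R) : IsSplitEpi (π M N) :=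
  IsSplitEpi.mk' ⟨ι M N, ι_π M N⟩

theorem π_balanced (M : Bimodule P Q) (N : Bimodule Q R) :
    M.r ▷ N.X ≫ π M N = (α_ _ _ _).hom ≫ M.X ◁ N.l ≫ π M N := by
  have h := idem_balanced M N
  unfold Balanced at h
  rw [← π_ι] at h
  have := congrArg (· ≫ π M N) h
  simpa using this

theorem π_desc (M : Bimodule P Q) (N : Bimodule Q R) {Z : P.base ⟶ R.base} (h : M.X ≫ N.X ⟶ Z)
    (hh : Balanced M N h) : π M N ≫ ι M N ≫ h = h := by
  rw [reassoc_of% @π_ι, idem_comp M N h hh]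

theorem π_descL (M : Bimodule P Q) (N : Bimodule Q R) {d : B} (W : d ⟶ P.base) {Z : d ⟶ R.base}
    (h : W ≫ M.X ≫ N.X ⟶ Z)
    (hh : W ◁ (M.r ▷ N.X) ≫ h = W ◁ ((α_ _ _ _).hom ≫ M.X ◁ N.l) ≫ h) :
    W ◁ π M N ≫ W ◁ ι M N ≫ h = h := by
  rw [← whiskerLeft_comp_assoc, π_ι]
  simp only [idem, whiskerLeft_comp, Category.assoc]
  rw [hh]
  simp only [← whiskerLeft_comp_assoc, Iso.inv_hom_id_assoc]
  simp only [← whiskerLeft_comp, sec_l]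
  simp

theorem π_descR (M : Bimodule P Q) (N : Bimodule Q R) {d : B} (W : R.base ⟶ d) {Z : P.base ⟶ d}
    (h : (M.X ≫ N.X) ≫ W ⟶ Z)
    (hh : (M.r ▷ N.X) ▷ W ≫ h = ((α_ _ _ _).hom ≫ M.X ◁ N.l) ▷ W ≫ h) :
    π M N ▷ W ≫ ι M N ▷ W ≫ h = h := by
  rw [← comp_whiskerRight_assoc, π_ι]
  simp only [idem, comp_whiskerRight, Category.assoc]
  rw [hh]
  simp only [← comp_whiskerRight_assoc, Iso.inv_hom_id_assoc,
    ← whiskerLeft_comp, sec_l]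
  simp

/-- The action of the source algebra on the relative tensor product. -/
noncomputable def tensorL (M : Bimodule P Q) (N : Bimodule Q R) : P.alg ≫ tensorX M N ⟶ tensorX M N :=
  P.alg ◁ ι M N ≫ (α_ _ _ _).inv ≫ M.l ▷ N.X ≫ π M N

/-- The action of the target algebra on the relative tensor product. -/
noncomputable def tensorR (M : Bimodule P Q) (N : Bimodule Q R) : tensorX M N ≫ R.alg ⟶ tensorX M N :=
  ι M N ▷ R.alg ≫ (α_ _ _ _).hom ≫ M.X ◁ N.r ≫ π M N

theorem π_tensorL (M : Bimodule P Q) (N : Bimodule Q R) :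
    P.alg ◁ π M N ≫ tensorL M N = (α_ _ _ _).inv ≫ M.l ▷ N.X ≫ π M N := by
  refine π_descL M N _ _ ?_
  calc _ = 𝟙 _ ⊗≫ ((α_ _ _ _).hom ≫ P.alg ◁ M.r ≫ M.l) ▷ N.X ⊗≫ π M N := by bicategory
    _ = 𝟙 _ ⊗≫ M.l ▷ Q.alg ▷ N.X ⊗≫ (M.r ▷ N.X ≫ π M N) := by rw [← M.middle]; bicategory
    _ = 𝟙 _ ⊗≫ (M.l ▷ (Q.alg ≫ N.X) ≫ M.X ◁ N.l) ⊗≫ π M N := by rw [π_balanced]; bicategory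
    _ = _ := by rw [← whisker_exchange]; bicategory

theorem π_tensorR (M : Bimodule P Q) (N : Bimodule Q R) :
    π M N ▷ R.alg ≫ tensorR M N = (α_ _ _ _).hom ≫ M.X ◁ N.r ≫ π M N := by
  refine π_descR M N _ _ ?_
  calc _ = 𝟙 _ ⊗≫ (M.r ▷ (N.X ≫ R.alg) ≫ M.X ◁ N.r) ⊗≫ π M N := by bicategory
    _ = 𝟙 _ ⊗≫ (M.X ≫ Q.alg) ◁ N.r ⊗≫ (M.r ▷ N.X ≫ π M N) := by
      rw [← whisker_exchange]; bicategory
    _ = 𝟙 _ ⊗≫ M.X ◁ ((α_ _ _ _).hom ≫ Q.alg ◁ N.r ≫ N.l) ⊗≫ π M N := by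
      rw [π_balanced]; bicategory
    _ = _ := by rw [← N.middle]; bicategory

/-- Horizontal composition in the equivariant completion: the tensor product over the intermediate
algebra. Its underlying 1-morphism is the coequalizer of the two actions, see
`isRelativeTensor_pr`. -/
noncomputable def tensor (M : Bimodule P Q) (N : Bimodule Q R) : Bimodule P R where
  X := tensorX M N
  l := tensorL M N
  r := tensorR M N
  one_l := by
    rw [← cancel_epi (𝟙 _ ◁ π M N), whisker_exchange_assoc, π_tensorL]
    calc _ = 𝟙 _ ⊗≫ (P.frob.one ▷ M.X ≫ M.l) ▷ N.X ⊗≫ π M N := by bicategory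
      _ = _ := by rw [M.one_l]; bicategory
  mul_l := by
    rw [← cancel_epi ((P.alg ≫ P.alg) ◁ π M N), whisker_exchange_assoc, π_tensorL]
    calc _ = 𝟙 _ ⊗≫ (P.frob.mul ▷ M.X ≫ M.l) ▷ N.X ⊗≫ π M N := by bicategory
      _ = 𝟙 _ ⊗≫ P.alg ◁ M.l ▷ N.X ⊗≫ ((α_ _ _ _).inv ≫ M.l ▷ N.X ≫ π M N) := by
        rw [M.mul_l]; bicategory
      _ = 𝟙 _ ⊗≫ P.alg ◁ M.l ▷ N.X ⊗≫ (P.alg ◁ π M N ≫ tensorL M N) := by rw [π_tensorL]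
      _ = 𝟙 _ ⊗≫ P.alg ◁ ((α_ _ _ _).inv ≫ M.l ▷ N.X ≫ π M N) ⊗≫ tensorL M N := by bicategory
      _ = _ := by rw [← π_tensorL]; bicategory
  r_one := by
    rw [← cancel_epi (π M N ▷ 𝟙 _), ← whisker_exchange_assoc, π_tensorR]
    calc _ = 𝟙 _ ⊗≫ M.X ◁ (N.X ◁ R.frob.one ≫ N.r) ⊗≫ π M N := by bicategory
      _ = _ := by rw [N.r_one]; bicategory
  r_mul := by
    rw [← cancel_epi (π M N ▷ (R.alg ≫ R.alg)), ← whisker_exchange_assoc, π_tensorR]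
    calc _ = 𝟙 _ ⊗≫ M.X ◁ (N.X ◁ R.frob.mul ≫ N.r) ⊗≫ π M N := by bicategory
      _ = 𝟙 _ ⊗≫ M.X ◁ N.r ▷ R.alg ⊗≫ ((α_ _ _ _).hom ≫ M.X ◁ N.r ≫ π M N) := by
        rw [N.r_mul]; bicategory
      _ = 𝟙 _ ⊗≫ M.X ◁ N.r ▷ R.alg ⊗≫ (π M N ▷ R.alg ≫ tensorR M N) := by rw [π_tensorR]
      _ = 𝟙 _ ⊗≫ ((α_ _ _ _).hom ≫ M.X ◁ N.r ≫ π M N) ▷ R.alg ⊗≫ tensorR M N := by bicategory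
      _ = _ := by rw [← π_tensorR]; bicategory
  middle := by
    rw [← cancel_epi ((P.alg ◁ π M N) ▷ R.alg), ← comp_whiskerRight_assoc, π_tensorL]
    calc ((α_ _ _ _).inv ≫ M.l ▷ N.X ≫ π M N) ▷ R.alg ≫ tensorR M N = 𝟙 _ ⊗≫ M.l ▷ N.X ▷ R.alg ⊗≫ (π M N ▷ R.alg ≫ tensorR M N) := by bicategory
      _ = 𝟙 _ ⊗≫ (M.l ▷ (N.X ≫ R.alg) ≫ M.X ◁ N.r) ⊗≫ π M N := by rw [π_tensorR]; bicategory
      _ = 𝟙 _ ⊗≫ P.alg ◁ (M.X ◁ N.r) ⊗≫ ((α_ _ _ _).inv ≫ M.l ▷ N.X ≫ π M N) := by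
        rw [← whisker_exchange]; bicategory
      _ = 𝟙 _ ⊗≫ P.alg ◁ ((α_ _ _ _).hom ≫ M.X ◁ N.r ≫ π M N) ⊗≫ tensorL M N := by
        rw [← π_tensorL]; bicategory
      _ = _ := by rw [← π_tensorR]; bicategory




/-- The inclusion of the relative tensor product in the tensor product. -/
noncomputable def incl (M : Bimodule P Q) (N : Bimodule Q R) : (tensor M N).X ⟶ M.X ≫ N.X := ι M N

/-- The projection from the tensor product to the relative tensor product. -/
noncomputable def pr (M : Bimodule P Q) (N : Bimodule Q R) : M.X ≫ N.X ⟶ (tensor M N).X := π M N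

theorem incl_pr (M : Bimodule P Q) (N : Bimodule Q R) : incl M N ≫ pr M N = 𝟙 _ := ι_π M N

theorem pr_incl (M : Bimodule P Q) (N : Bimodule Q R) : pr M N ≫ incl M N = idem M N := π_ι M N

instance isSplitEpi_pr (M : Bimodule P Q) (N : Bimodule Q R) : IsSplitEpi (pr M N) := isSplitEpi_π M N

theorem pr_balanced (M : Bimodule P Q) (N : Bimodule Q R) :
    M.r ▷ N.X ≫ pr M N = (α_ _ _ _).hom ≫ M.X ◁ N.l ≫ pr M N := π_balanced M N

theorem pr_desc (M : Bimodule P Q) (N : Bimodule Q R) {Z : P.base ⟶ R.base} (h : M.X ≫ N.X ⟶ Z)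
    (hh : Balanced M N h) : pr M N ≫ incl M N ≫ h = h := π_desc M N h hh

theorem pr_descL (M : Bimodule P Q) (N : Bimodule Q R) {d : B} (W : d ⟶ P.base) {Z : d ⟶ R.base}
    (h : W ≫ M.X ≫ N.X ⟶ Z)
    (hh : W ◁ (M.r ▷ N.X) ≫ h = W ◁ ((α_ _ _ _).hom ≫ M.X ◁ N.l) ≫ h) :
    W ◁ pr M N ≫ W ◁ incl M N ≫ h = h := π_descL M N W h hh

theorem pr_descR (M : Bimodule P Q) (N : Bimodule Q R) {d : B} (W : R.base ⟶ d) {Z : P.base ⟶ d}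
    (h : (M.X ≫ N.X) ≫ W ⟶ Z)
    (hh : (M.r ▷ N.X) ▷ W ≫ h = ((α_ _ _ _).hom ≫ M.X ◁ N.l) ▷ W ≫ h) :
    pr M N ▷ W ≫ incl M N ▷ W ≫ h = h := π_descR M N W h hh

theorem pr_l (M : Bimodule P Q) (N : Bimodule Q R) :
    P.alg ◁ pr M N ≫ (tensor M N).l = (α_ _ _ _).inv ≫ M.l ▷ N.X ≫ pr M N := π_tensorL M N

theorem pr_r (M : Bimodule P Q) (N : Bimodule Q R) :
    pr M N ▷ R.alg ≫ (tensor M N).r = (α_ _ _ _).hom ≫ M.X ◁ N.r ≫ pr M N := π_tensorR M N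

theorem whiskerL_balanced (M : Bimodule P Q) {N N' : Bimodule Q R} (g : N ⟶ N') :
    Balanced M N (M.X ◁ g.hom ≫ pr M N') := by
  unfold Balanced
  rw [← whisker_exchange_assoc, pr_balanced, ← whiskerLeft_comp_assoc, g.l_comm]
  simp

theorem whiskerR_balanced {M M' : Bimodule P Q} (f : M ⟶ M') (N : Bimodule Q R) :
    Balanced M N (f.hom ▷ N.X ≫ pr M' N) := by
  unfold Balanced
  rw [whisker_exchange_assoc, ← comp_whiskerRight_assoc, f.r_comm, comp_whiskerRight,
    Category.assoc, pr_balanced]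
  simp

theorem pr_whiskerL (M : Bimodule P Q) {N N' : Bimodule Q R} (g : N ⟶ N') :
    pr M N ≫ (incl M N ≫ M.X ◁ g.hom ≫ pr M N') = M.X ◁ g.hom ≫ pr M N' :=
  pr_desc _ _ _ (whiskerL_balanced M g)

theorem pr_whiskerR {M M' : Bimodule P Q} (f : M ⟶ M') (N : Bimodule Q R) :
    pr M N ≫ (incl M N ≫ f.hom ▷ N.X ≫ pr M' N) = f.hom ▷ N.X ≫ pr M' N :=
  pr_desc _ _ _ (whiskerR_balanced f N)

/-- A map out of a relative tensor product is a bimodule map as soon as it is one on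
representatives. -/
theorem isHom_of_pr {M : Bimodule P Q} {N : Bimodule Q R} {K : Bimodule P R} (t : (tensor M N).X ⟶ K.X)
    (hl : M.l ▷ N.X ≫ pr M N ≫ t = (α_ _ _ _).hom ≫ P.alg ◁ (pr M N ≫ t) ≫ K.l)
    (hr : M.X ◁ N.r ≫ pr M N ≫ t = (α_ _ _ _).inv ≫ (pr M N ≫ t) ▷ R.alg ≫ K.r) :
    (tensor M N).l ≫ t = P.alg ◁ t ≫ K.l ∧ (tensor M N).r ≫ t = t ▷ R.alg ≫ K.r := by
  constructor
  · rw [← cancel_epi (P.alg ◁ pr M N), reassoc_of% @pr_l, hl]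
    simp
  · rw [← cancel_epi (pr M N ▷ R.alg), reassoc_of% @pr_r, hr]
    simp

/-- The bimodule map out of a relative tensor product induced by a balanced map that commutes
with the outer actions. -/
noncomputable def desc {M : Bimodule P Q} {N : Bimodule Q R} {K : Bimodule P R} (h : M.X ≫ N.X ⟶ K.X)
    (hb : Balanced M N h)
    (hl : M.l ▷ N.X ≫ h = (α_ _ _ _).hom ≫ P.alg ◁ h ≫ K.l)
    (hr : M.X ◁ N.r ≫ h = (α_ _ _ _).inv ≫ h ▷ R.alg ≫ K.r) : tensor M N ⟶ K where
  hom := incl M N ≫ h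
  l_comm := (isHom_of_pr (K := K) (incl M N ≫ h) (by rw [pr_desc _ _ _ hb, hl])
    (by rw [pr_desc _ _ _ hb, hr])).1
  r_comm := (isHom_of_pr (K := K) (incl M N ≫ h) (by rw [pr_desc _ _ _ hb, hl])
    (by rw [pr_desc _ _ _ hb, hr])).2

@[simp]
theorem pr_desc_hom {M : Bimodule P Q} {N : Bimodule Q R} {K : Bimodule P R} (h : M.X ≫ N.X ⟶ K.X)
    (hb : Balanced M N h) (hl) (hr) : pr M N ≫ (desc (K := K) h hb hl hr).hom = h :=
  pr_desc _ _ _ hb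

theorem tensor_hom_ext {M : Bimodule P Q} {N : Bimodule Q R} {K : Bimodule P R} {f g : tensor M N ⟶ K}
    (h : pr M N ≫ f.hom = pr M N ≫ g.hom) : f = g :=
  hom_ext ((cancel_epi (pr M N)).1 h)

/-- Left whiskering in the equivariant completion, induced by `M.X ◁ g.hom`. -/
noncomputable def whiskerL (M : Bimodule P Q) {N N' : Bimodule Q R} (g : N ⟶ N') :
    tensor M N ⟶ tensor M N' :=
  desc (M.X ◁ g.hom ≫ pr M N') (whiskerL_balanced M g)
    (by
      calc _ = (M.l ▷ N.X ≫ M.X ◁ g.hom) ≫ pr M N' := by simp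
        _ = 𝟙 _ ⊗≫ P.alg ◁ M.X ◁ g.hom ⊗≫ ((α_ _ _ _).inv ≫ M.l ▷ N'.X ≫ pr M N') := by
          rw [← whisker_exchange]; bicategory
        _ = 𝟙 _ ⊗≫ P.alg ◁ M.X ◁ g.hom ⊗≫ (P.alg ◁ pr M N' ≫ (tensor M N').l) := by rw [pr_l]
        _ = (α_ _ _ _).hom ≫ P.alg ◁ (M.X ◁ g.hom ≫ pr M N') ≫ (tensor M N').l := by bicategory)
    (by
      calc _ = M.X ◁ (N.r ≫ g.hom) ≫ pr M N' := by simp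
        _ = 𝟙 _ ⊗≫ M.X ◁ g.hom ▷ R.alg ⊗≫ ((α_ _ _ _).hom ≫ M.X ◁ N'.r ≫ pr M N') := by
          rw [g.r_comm]; bicategory
        _ = 𝟙 _ ⊗≫ M.X ◁ g.hom ▷ R.alg ⊗≫ (pr M N' ▷ R.alg ≫ (tensor M N').r) := by rw [pr_r]
        _ = (α_ _ _ _).inv ≫ (M.X ◁ g.hom ≫ pr M N') ▷ R.alg ≫ (tensor M N').r := by bicategory)

/-- Right whiskering in the equivariant completion, induced by `f.hom ▷ N.X`. -/
noncomputable def whiskerR {M M' : Bimodule P Q} (f : M ⟶ M') (N : Bimodule Q R) :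
    tensor M N ⟶ tensor M' N :=
  desc (f.hom ▷ N.X ≫ pr M' N) (whiskerR_balanced f N)
    (by
      calc _ = (M.l ≫ f.hom) ▷ N.X ≫ pr M' N := by simp
        _ = 𝟙 _ ⊗≫ P.alg ◁ f.hom ▷ N.X ⊗≫ ((α_ _ _ _).inv ≫ M'.l ▷ N.X ≫ pr M' N) := by
          rw [f.l_comm]; bicategory
        _ = 𝟙 _ ⊗≫ P.alg ◁ f.hom ▷ N.X ⊗≫ (P.alg ◁ pr M' N ≫ (tensor M' N).l) := by rw [pr_l]
        _ = (α_ _ _ _).hom ≫ P.alg ◁ (f.hom ▷ N.X ≫ pr M' N) ≫ (tensor M' N).l := by bicategory)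
    (by
      calc _ = (M.X ◁ N.r ≫ f.hom ▷ N.X) ≫ pr M' N := by simp
        _ = 𝟙 _ ⊗≫ f.hom ▷ N.X ▷ R.alg ⊗≫ ((α_ _ _ _).hom ≫ M'.X ◁ N.r ≫ pr M' N) := by
          rw [whisker_exchange]; bicategory
        _ = 𝟙 _ ⊗≫ f.hom ▷ N.X ▷ R.alg ⊗≫ (pr M' N ▷ R.alg ≫ (tensor M' N).r) := by rw [pr_r]
        _ = (α_ _ _ _).inv ≫ (f.hom ▷ N.X ≫ pr M' N) ▷ R.alg ≫ (tensor M' N).r := by bicategory)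

@[simp]
theorem pr_whiskerL_hom (M : Bimodule P Q) {N N' : Bimodule Q R} (g : N ⟶ N') :
    pr M N ≫ (whiskerL M g).hom = M.X ◁ g.hom ≫ pr M N' :=
  pr_desc_hom ..

@[simp]
theorem pr_whiskerR_hom {M M' : Bimodule P Q} (f : M ⟶ M') (N : Bimodule Q R) :
    pr M N ≫ (whiskerR f N).hom = f.hom ▷ N.X ≫ pr M' N :=
  pr_desc_hom ..

/-- The identity 1-morphism of `P`: the algebra as a bimodule over itself. -/
abbrev unit (P : EquivariantCompletion B) : Bimodule P P where
  X := P.alg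
  l := P.frob.mul
  r := P.frob.mul
  one_l := P.frob.one_mul
  mul_l := P.frob.mul_assoc
  r_one := P.frob.mul_one
  r_mul := by rw [P.frob.mul_assoc]; simp
  middle := P.frob.mul_assoc

/-- The left unitor map, induced by the action. -/
noncomputable def leftUnitorHom (M : Bimodule P Q) : tensor (unit P) M ⟶ M :=
  desc M.l M.mul_l M.mul_l (by rw [M.middle]; simp)

/-- The right unitor map, induced by the action. -/
noncomputable def rightUnitorHom (M : Bimodule P Q) : tensor M (unit Q) ⟶ M :=
  desc M.r (by unfold Balanced; rw [M.r_mul]; simp) M.middle M.r_mul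

@[simp]
theorem pr_leftUnitorHom (M : Bimodule P Q) : pr (unit P) M ≫ (leftUnitorHom M).hom = M.l :=
  pr_desc_hom ..

@[simp]
theorem pr_rightUnitorHom (M : Bimodule P Q) : pr M (unit Q) ≫ (rightUnitorHom M).hom = M.r :=
  pr_desc_hom ..

/-- The left unitor. -/
noncomputable def leftUnitor (M : Bimodule P Q) : tensor (unit P) M ≅ M :=
  isoMk
    { hom := (leftUnitorHom M).hom
      inv := (λ_ M.X).inv ≫ P.frob.one ▷ M.X ≫ pr (unit P) M
      hom_inv_id := by
        rw [← cancel_epi (pr (unit P) M), reassoc_of% @pr_leftUnitorHom]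
        calc _ = 𝟙 _ ⊗≫ (𝟙 _ ◁ M.l ≫ P.frob.one ▷ M.X) ⊗≫ pr (unit P) M := by bicategory
          _ = 𝟙 _ ⊗≫ P.frob.one ▷ (P.alg ≫ M.X) ⊗≫
              ((α_ _ _ _).hom ≫ (unit P).X ◁ M.l ≫ pr (unit P) M) := by
            rw [whisker_exchange]; bicategory
          _ = 𝟙 _ ⊗≫ (P.frob.one ▷ P.alg ≫ P.frob.mul) ▷ M.X ⊗≫ pr (unit P) M := by
            rw [← pr_balanced]; bicategory
          _ = pr (unit P) M ≫ 𝟙 _ := by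
            rw [P.frob.one_mul]; bicategory
      inv_hom_id := by simp [M.one_l] }
    (leftUnitorHom M).l_comm (leftUnitorHom M).r_comm

/-- The right unitor. -/
noncomputable def rightUnitor (M : Bimodule P Q) : tensor M (unit Q) ≅ M :=
  isoMk
    { hom := (rightUnitorHom M).hom
      inv := (ρ_ M.X).inv ≫ M.X ◁ Q.frob.one ≫ pr M (unit Q)
      hom_inv_id := by
        rw [← cancel_epi (pr M (unit Q)), reassoc_of% @pr_rightUnitorHom]
        calc _ = 𝟙 _ ⊗≫ (M.r ▷ 𝟙 _ ≫ M.X ◁ Q.frob.one) ⊗≫ pr M (unit Q) := by bicategory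
          _ = 𝟙 _ ⊗≫ (M.X ≫ Q.alg) ◁ Q.frob.one ⊗≫
              (M.r ▷ (unit Q).X ≫ pr M (unit Q)) := by
            rw [← whisker_exchange]; bicategory
          _ = 𝟙 _ ⊗≫ M.X ◁ (Q.alg ◁ Q.frob.one ≫ Q.frob.mul) ⊗≫ pr M (unit Q) := by
            rw [pr_balanced]; bicategory
          _ = pr M (unit Q) ≫ 𝟙 _ := by
            rw [Q.frob.mul_one]; bicategory
      inv_hom_id := by simp [M.r_one] }
    (rightUnitorHom M).l_comm (rightUnitorHom M).r_comm

section assoc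
variable (M : Bimodule P Q) (N : Bimodule Q R) (K : Bimodule R S)

/-- Auxiliary map for the associator. -/
noncomputable def assocAux : (tensor M N).X ≫ K.X ⟶ (tensor M (tensor N K)).X :=
  incl M N ▷ K.X ≫ (α_ _ _ _).hom ≫ M.X ◁ pr N K ≫ pr M (tensor N K)

theorem pr_assocAux : pr M N ▷ K.X ≫ assocAux M N K =
    (α_ _ _ _).hom ≫ M.X ◁ pr N K ≫ pr M (tensor N K) := by
  refine pr_descR M N _ _ ?_
  calc _ = 𝟙 _ ⊗≫ (M.r ▷ (N.X ≫ K.X) ≫ M.X ◁ pr N K) ⊗≫ pr M (tensor N K) := by bicategory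
    _ = 𝟙 _ ⊗≫ (M.X ≫ Q.alg) ◁ pr N K ⊗≫ (M.r ▷ (tensor N K).X ≫ pr M (tensor N K)) := by
      rw [← whisker_exchange]; bicategory
    _ = 𝟙 _ ⊗≫ M.X ◁ (Q.alg ◁ pr N K ≫ (tensor N K).l) ⊗≫ pr M (tensor N K) := by
      rw [pr_balanced]; bicategory
    _ = _ := by rw [pr_l]; bicategory

/-- The associator map, induced by the associator of `B`. -/
noncomputable def assocHom : tensor (tensor M N) K ⟶ tensor M (tensor N K) :=
  desc (assocAux M N K)
    (by
      unfold Balanced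
      rw [← cancel_epi ((pr M N ▷ R.alg) ▷ K.X)]
      calc _ = (pr M N ▷ R.alg ≫ (tensor M N).r) ▷ K.X ≫ assocAux M N K := by simp
        _ = 𝟙 _ ⊗≫ (M.X ◁ N.r) ▷ K.X ⊗≫ (pr M N ▷ K.X ≫ assocAux M N K) := by
          rw [pr_r]; bicategory
        _ = 𝟙 _ ⊗≫ M.X ◁ (N.r ▷ K.X ≫ pr N K) ⊗≫ pr M (tensor N K) := by
          rw [pr_assocAux]; bicategory
        _ = 𝟙 _ ⊗≫ (M.X ≫ N.X) ◁ K.l ⊗≫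
            ((α_ _ _ _).hom ≫ M.X ◁ pr N K ≫ pr M (tensor N K)) := by
          rw [pr_balanced]; bicategory
        _ = 𝟙 _ ⊗≫ ((M.X ≫ N.X) ◁ K.l ≫ pr M N ▷ K.X) ⊗≫ assocAux M N K := by
          rw [← pr_assocAux]; bicategory
        _ = _ := by rw [whisker_exchange]; bicategory)
    (by
      rw [← cancel_epi ((P.alg ◁ pr M N) ▷ K.X)]
      calc _ = (P.alg ◁ pr M N ≫ (tensor M N).l) ▷ K.X ≫ assocAux M N K := by simp
        _ = 𝟙 _ ⊗≫ M.l ▷ N.X ▷ K.X ⊗≫ (pr M N ▷ K.X ≫ assocAux M N K) := by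
          rw [pr_l]; bicategory
        _ = 𝟙 _ ⊗≫ (M.l ▷ (N.X ≫ K.X) ≫ M.X ◁ pr N K) ⊗≫ pr M (tensor N K) := by
          rw [pr_assocAux]; bicategory
        _ = 𝟙 _ ⊗≫ P.alg ◁ M.X ◁ pr N K ⊗≫
            ((α_ _ _ _).inv ≫ M.l ▷ (tensor N K).X ≫ pr M (tensor N K)) := by
          rw [← whisker_exchange]; bicategory
        _ = 𝟙 _ ⊗≫ P.alg ◁ ((α_ _ _ _).hom ≫ M.X ◁ pr N K ≫ pr M (tensor N K)) ⊗≫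
            (tensor M (tensor N K)).l := by
          rw [← pr_l]; bicategory
        _ = _ := by rw [← pr_assocAux]; bicategory)
    (by
      rw [← cancel_epi (pr M N ▷ (K.X ≫ S.alg)), ← whisker_exchange_assoc, pr_assocAux]
      calc _ = 𝟙 _ ⊗≫ M.X ◁ ((α_ _ _ _).hom ≫ N.X ◁ K.r ≫ pr N K) ⊗≫ pr M (tensor N K) := by
            bicategory
        _ = 𝟙 _ ⊗≫ M.X ◁ (pr N K ▷ S.alg) ⊗≫
            ((α_ _ _ _).hom ≫ M.X ◁ (tensor N K).r ≫ pr M (tensor N K)) := by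
          rw [← pr_r]; bicategory
        _ = 𝟙 _ ⊗≫ ((α_ _ _ _).hom ≫ M.X ◁ pr N K ≫ pr M (tensor N K)) ▷ S.alg ⊗≫
            (tensor M (tensor N K)).r := by
          rw [← pr_r]; bicategory
        _ = _ := by rw [← pr_assocAux]; bicategory)

@[simp]
theorem pr_assocHom : pr M N ▷ K.X ≫ pr (tensor M N) K ≫ (assocHom M N K).hom =
    (α_ _ _ _).hom ≫ M.X ◁ pr N K ≫ pr M (tensor N K) := by
  rw [← pr_assocAux]
  congr 1
  exact pr_desc_hom ..

/-- Auxiliary map for the inverse of the associator. -/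
noncomputable def assocInvAux : M.X ≫ (tensor N K).X ⟶ (tensor (tensor M N) K).X :=
  M.X ◁ incl N K ≫ (α_ _ _ _).inv ≫ pr M N ▷ K.X ≫ pr (tensor M N) K

theorem pr_assocInvAux : M.X ◁ pr N K ≫ assocInvAux M N K =
    (α_ _ _ _).inv ≫ pr M N ▷ K.X ≫ pr (tensor M N) K := by
  refine pr_descL N K _ _ ?_
  calc _ = 𝟙 _ ⊗≫ ((α_ _ _ _).hom ≫ M.X ◁ N.r ≫ pr M N) ▷ K.X ⊗≫ pr (tensor M N) K := by bicategory
    _ = 𝟙 _ ⊗≫ pr M N ▷ R.alg ▷ K.X ⊗≫ ((tensor M N).r ▷ K.X ≫ pr (tensor M N) K) := by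
      rw [← pr_r]; bicategory
    _ = 𝟙 _ ⊗≫ (pr M N ▷ (R.alg ≫ K.X) ≫ (tensor M N).X ◁ K.l) ⊗≫ pr (tensor M N) K := by
      rw [pr_balanced]; bicategory
    _ = _ := by rw [← whisker_exchange]; bicategory

theorem assocInvAux_balanced : Balanced M (tensor N K) (assocInvAux M N K) := by
  unfold Balanced
  rw [← cancel_epi ((M.X ≫ Q.alg) ◁ pr N K), whisker_exchange_assoc, pr_assocInvAux]
  calc _ = 𝟙 _ ⊗≫ (M.r ▷ N.X ≫ pr M N) ▷ K.X ⊗≫ pr (tensor M N) K := by bicategory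
    _ = 𝟙 _ ⊗≫ M.X ◁ N.l ▷ K.X ⊗≫
        ((α_ _ _ _).inv ≫ pr M N ▷ K.X ≫ pr (tensor M N) K) := by rw [pr_balanced]; bicategory
    _ = 𝟙 _ ⊗≫ M.X ◁ ((α_ _ _ _).inv ≫ N.l ▷ K.X ≫ pr N K) ⊗≫ assocInvAux M N K := by
      rw [← pr_assocInvAux]; bicategory
    _ = _ := by rw [← pr_l]; bicategory

/-- The inverse of the associator map. -/
noncomputable def assocInv : (tensor M (tensor N K)).X ⟶ (tensor (tensor M N) K).X :=
  incl M (tensor N K) ≫ assocInvAux M N K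

theorem pr_assocInv : M.X ◁ pr N K ≫ pr M (tensor N K) ≫ assocInv M N K =
    (α_ _ _ _).inv ≫ pr M N ▷ K.X ≫ pr (tensor M N) K := by
  rw [← pr_assocInvAux]
  congr 1
  exact pr_desc _ _ _ (assocInvAux_balanced M N K)

/-- The associator. -/
noncomputable def associator : tensor (tensor M N) K ≅ tensor M (tensor N K) :=
  isoMk
    { hom := (assocHom M N K).hom
      inv := assocInv M N K
      hom_inv_id := by
        rw [← cancel_epi (pr (tensor M N) K)]
        rw [← cancel_epi (pr M N ▷ K.X)]
        have := (reassoc_of% (pr_assocHom M N K)) (assocInv M N K)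
        rw [pr_assocInv] at this
        simpa using this
      inv_hom_id := by
        rw [← cancel_epi (pr M (tensor N K))]
        rw [← cancel_epi (M.X ◁ pr N K)]
        have := (reassoc_of% (pr_assocInv M N K)) (assocHom M N K).hom
        rw [pr_assocHom] at this
        simpa using this }
    (assocHom M N K).l_comm (assocHom M N K).r_comm

end assoc


@[simp]
theorem pr_leftUnitor (M : Bimodule P Q) : pr (unit P) M ≫ (leftUnitor M).hom.hom = M.l :=
  pr_leftUnitorHom M

@[simp]
theorem pr_rightUnitor (M : Bimodule P Q) : pr M (unit Q) ≫ (rightUnitor M).hom.hom = M.r :=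
  pr_rightUnitorHom M

@[simp]
theorem pr_associator (M : Bimodule P Q) (N : Bimodule Q R) (K : Bimodule R S) :
    pr M N ▷ K.X ≫ pr (tensor M N) K ≫ (associator M N K).hom.hom =
    (α_ _ _ _).hom ≫ M.X ◁ pr N K ≫ pr M (tensor N K) :=
  pr_assocHom M N K

theorem tensor_hom_ext₃ {M : Bimodule P Q} {N : Bimodule Q R} {K : Bimodule R S} {L : Bimodule P S}
    {f g : tensor (tensor M N) K ⟶ L}
    (h : pr M N ▷ K.X ≫ pr (tensor M N) K ≫ f.hom = pr M N ▷ K.X ≫ pr (tensor M N) K ≫ g.hom) :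
    f = g :=
  tensor_hom_ext ((cancel_epi (pr M N ▷ K.X)).1 h)


theorem whiskerL_associator (M : Bimodule P Q) (N : Bimodule Q R) {K K' : Bimodule R S} (f : K ⟶ K') :
    whiskerL (tensor M N) f ≫ (associator M N K').hom =
      (associator M N K).hom ≫ whiskerL M (whiskerL N f) := by
  refine tensor_hom_ext₃ ?_
  simp only [comp_hom, reassoc_of% @pr_whiskerL_hom, reassoc_of% @pr_associator, pr_whiskerL_hom]
  rw [← whisker_exchange_assoc, pr_associator, ← whiskerLeft_comp_assoc, pr_whiskerL_hom]
  simp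

theorem whiskerR_associator {M M' : Bimodule P Q} (f : M ⟶ M') (N : Bimodule Q R) (K : Bimodule R S) :
    (associator M N K).hom ≫ whiskerR f (tensor N K) =
      whiskerR (whiskerR f N) K ≫ (associator M' N K).hom := by
  refine tensor_hom_ext₃ ?_
  simp only [comp_hom, reassoc_of% @pr_whiskerR_hom, reassoc_of% @pr_associator, pr_whiskerR_hom]
  rw [← comp_whiskerRight_assoc, pr_whiskerR_hom, comp_whiskerRight, Category.assoc,
    pr_associator, whisker_exchange_assoc]
  simp

theorem whiskerLR_associator (M : Bimodule P Q) {N N' : Bimodule Q R} (f : N ⟶ N') (K : Bimodule R S) :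
    whiskerR (whiskerL M f) K ≫ (associator M N' K).hom =
      (associator M N K).hom ≫ whiskerL M (whiskerR f K) := by
  refine tensor_hom_ext₃ ?_
  simp only [comp_hom, reassoc_of% @pr_whiskerR_hom, reassoc_of% @pr_associator, pr_whiskerL_hom]
  rw [← comp_whiskerRight_assoc, pr_whiskerL_hom, comp_whiskerRight, Category.assoc,
    pr_associator, ← whiskerLeft_comp_assoc, pr_whiskerR_hom]
  simp

theorem pentagon_tensor (M : Bimodule P Q) (N : Bimodule Q R) (K : Bimodule R S) (L : Bimodule S T) :
    whiskerR (associator M N K).hom L ≫ (associator M (tensor N K) L).hom ≫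
        whiskerL M (associator N K L).hom =
      (associator (tensor M N) K L).hom ≫ (associator M N (tensor K L)).hom := by
  refine tensor_hom_ext₃ ?_
  rw [← cancel_epi (pr M N ▷ K.X ▷ L.X)]
  simp only [comp_hom, reassoc_of% @pr_whiskerR_hom, reassoc_of% @pr_associator]
  have h1 := congrArg (fun t => t ▷ L.X) (pr_associator M N K)
  simp only [comp_whiskerRight] at h1
  rw [reassoc_of% h1]
  rw [reassoc_of% @pr_associator, pr_whiskerL_hom]
  calc _ = 𝟙 _ ⊗≫ M.X ◁ (pr N K ▷ L.X ≫ pr (tensor N K) L ≫ (associator N K L).hom.hom) ⊗≫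
        pr M (tensor N (tensor K L)) := by bicategory
    _ = 𝟙 _ ⊗≫ (M.X ≫ N.X) ◁ pr K L ⊗≫
        ((α_ _ _ _).hom ≫ M.X ◁ pr N (tensor K L) ≫ pr M (tensor N (tensor K L))) := by
      rw [pr_associator]; bicategory
    _ = 𝟙 _ ⊗≫ ((M.X ≫ N.X) ◁ pr K L ≫ pr M N ▷ (tensor K L).X) ⊗≫
        pr (tensor M N) (tensor K L) ≫ (associator M N (tensor K L)).hom.hom := by
      rw [← pr_associator]; bicategory
    _ = _ := by rw [whisker_exchange]; bicategory

theorem triangle_tensor (M : Bimodule P Q) (N : Bimodule Q R) :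
    (associator M (unit Q) N).hom ≫ whiskerL M (leftUnitor N).hom =
      whiskerR (rightUnitor M).hom N := by
  refine tensor_hom_ext₃ ?_
  simp only [comp_hom, pr_whiskerR_hom, reassoc_of% @pr_associator, pr_whiskerL_hom]
  rw [← comp_whiskerRight_assoc, pr_rightUnitor, ← whiskerLeft_comp_assoc, pr_leftUnitor,
    pr_balanced]

theorem isRelativeTensor_pr (M : Bimodule P Q) (N : Bimodule Q R) :
    IsRelativeTensor M.r N.l (pr M N) :=
  ⟨by rw [pr_balanced, Category.assoc], ⟨Cofork.IsColimit.mk _ (fun s => incl M N ≫ s.π)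
    (fun s => pr_desc M N s.π (by have := s.condition; rwa [Category.assoc] at this))
    (fun s m hm => (cancel_epi (pr M N)).1 (hm.trans
      (pr_desc M N s.π (by have := s.condition; rwa [Category.assoc] at this)).symm))⟩⟩

end tensor

section bicat

variable [∀ a b : B, IsIdempotentComplete (a ⟶ b)]

/-- The equivariant completion of a bicategory with idempotent complete categories of 1-morphisms:
objects are pairs `(a, A)` of an object and a separable Frobenius algebra on it, 1-morphisms are
bimodules, 2-morphisms are bimodule maps, horizontal composition is the tensor product over the
intermediate algebra, and the identity of `(a, A)` is `A`. -/
noncomputable instance instBicategory : Bicategory (EquivariantCompletion B) where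
  Hom P Q := Bimodule P Q
  id P := unit P
  comp M N := tensor M N
  homCategory P Q := inferInstanceAs (Category (Bimodule P Q))
  whiskerLeft M _ _ g := whiskerL M g
  whiskerRight f N := whiskerR f N
  associator M N K := associator M N K
  leftUnitor M := leftUnitor M
  rightUnitor M := rightUnitor M
  whiskerLeft_id M N := tensor_hom_ext (by simp)
  whiskerLeft_comp M _ _ _ f g := tensor_hom_ext (by simp [reassoc_of% @pr_whiskerL_hom])
  id_whiskerLeft {P Q M N} f := by
    rw [← Category.assoc, Iso.eq_comp_inv]
    refine tensor_hom_ext ?_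
    simp [f.l_comm, reassoc_of% @pr_whiskerL_hom, reassoc_of% @pr_leftUnitor]
  comp_whiskerLeft M N K K' f := by
    rw [← Category.assoc, Iso.eq_comp_inv]
    exact whiskerL_associator M N f
  id_whiskerRight M N := tensor_hom_ext (by simp)
  comp_whiskerRight f g N := tensor_hom_ext (by simp [reassoc_of% @pr_whiskerR_hom])
  whiskerRight_id {P Q M N} f := by
    rw [← Category.assoc, Iso.eq_comp_inv]
    refine tensor_hom_ext ?_
    simp [f.r_comm, reassoc_of% @pr_whiskerR_hom, reassoc_of% @pr_rightUnitor]
  whiskerRight_comp {P Q R S M M'} f N K := by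
    rw [Iso.eq_inv_comp]
    exact whiskerR_associator f N K
  whisker_assoc M N N' f K := by
    rw [← Category.assoc, Iso.eq_comp_inv]
    exact whiskerLR_associator M f K
  whisker_exchange {P Q R M M' N N'} f g := tensor_hom_ext (by
    simp [whisker_exchange_assoc, reassoc_of% @pr_whiskerL_hom,
      reassoc_of% @pr_whiskerR_hom])
  pentagon M N K L := pentagon_tensor M N K L
  triangle M N := triangle_tensor M N

end bicat

end Bimodule

/-- The trivial separable Frobenius algebra on the identity 1-morphism of `b`, as the object
`(b, 𝟙 b)` of the equivariant completion. -/
def EquivariantCompletion.trivial (b : B) : EquivariantCompletion B where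
  base := b
  alg := 𝟙 b
  frob :=
    { mul := (λ_ (𝟙 b)).hom
      one := 𝟙 (𝟙 b)
      comul := (λ_ (𝟙 b)).inv
      counit := 𝟙 (𝟙 b)
      one_mul := by simp
      mul_one := by simp [unitors_equal]
      mul_assoc := by simp [unitors_equal]
      counit_comul := by simp
      comul_counit := by simp [unitors_inv_equal]
      comul_assoc := by bicategory
      frobenius_left := by bicategory
      frobenius_right := by bicategory }
  separable := by simp [FrobeniusAlgebra.IsSeparable]

/-- A bicategory with adjoints: every 1-morphism `X : a ⟶ b` has a (chosen) left adjoint and a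
(chosen) right adjoint. The maps `ev : ᵗX ⊗ X → I_a` and `coev : I_b → X ⊗ ᵗX` of the left adjoint
are `(leftAdj X).counit` and `(leftAdj X).unit`, and the maps `I_a → Xᵗ ⊗ X` and `X ⊗ Xᵗ → I_b` of
the right adjoint are `(rightAdj X).unit` and `(rightAdj X).counit`. -/
class BicategoryWithAdjoints (B : Type u) [Bicategory.{w, v} B] where
  leftDual {a b : B} (X : a ⟶ b) : b ⟶ a
  leftAdj {a b : B} (X : a ⟶ b) : leftDual X ⊣ X
  rightDual {a b : B} (X : a ⟶ b) : b ⟶ a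
  rightAdj {a b : B} (X : a ⟶ b) : X ⊣ rightDual X

open BicategoryWithAdjoints

variable [BicategoryWithAdjoints B] {a b : B}

/-- The right trace of a 2-morphism from the left to the right adjoint of `X`. -/
def trR (X : a ⟶ b) (φ : leftDual X ⟶ rightDual X) : 𝟙 b ⟶ 𝟙 b :=
  (leftAdj X).unit ≫ φ ▷ X ≫ (rightAdj X).counit

/-- The action `X ⊗ A → X` of `A = Xᵗ ⊗ X` on `X`, where `Xᵗ` is the right adjoint. -/
def actX (X : a ⟶ b) : (X ≫ rightDual X) ≫ X ⟶ X :=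
  (α_ X (rightDual X) X).hom ≫ X ◁ (rightAdj X).counit ≫ (ρ_ X).hom

/-- The action `A ⊗ Xᵗ → Xᵗ` of `A = Xᵗ ⊗ X` on the right adjoint `Xᵗ` of `X`. -/
def actDual (X : a ⟶ b) : rightDual X ≫ (X ≫ rightDual X) ⟶ rightDual X :=
  (α_ (rightDual X) X (rightDual X)).inv ≫ (rightAdj X).counit ▷ rightDual X ≫
    (λ_ (rightDual X)).hom

/-- The multiplication `A ⊗ A → A` of `A = Xᵗ ⊗ X`, contracting the inner factors by
`X ⊗ Xᵗ → I_b`. -/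
def endMul (X : a ⟶ b) :
    (X ≫ rightDual X) ≫ (X ≫ rightDual X) ⟶ X ≫ rightDual X :=
  (α_ X (rightDual X) (X ≫ rightDual X)).hom ≫ X ◁ actDual X

/-- The comultiplication `A → A ⊗ A` of `A = Xᵗ ⊗ X`, inserting
`s` followed by `I_b → X ⊗ ᵗX → X ⊗ Xᵗ` in the middle. -/
def endComul (X : a ⟶ b) (φ : leftDual X ≅ rightDual X) (s : 𝟙 b ⟶ 𝟙 b) :
    X ≫ rightDual X ⟶ (X ≫ rightDual X) ≫ (X ≫ rightDual X) :=
  X ◁ ((λ_ (rightDual X)).inv ≫ (s ≫ (leftAdj X).unit ≫ φ.hom ▷ X) ▷ rightDual X ≫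
    (α_ (rightDual X) X (rightDual X)).hom) ≫ (α_ X (rightDual X) (X ≫ rightDual X)).inv

/-- The counit `A → I_a` of `A = Xᵗ ⊗ X`: insert `t` in the middle, then apply
`Xᵗ ⊗ X → ᵗX ⊗ X → I_a`. -/
def endCounit (X : a ⟶ b) (φ : leftDual X ≅ rightDual X) (t : 𝟙 b ⟶ 𝟙 b) :
    X ≫ rightDual X ⟶ 𝟙 a :=
  X ◁ ((λ_ (rightDual X)).inv ≫ t ▷ rightDual X ≫ (λ_ (rightDual X)).hom ≫ φ.inv) ≫
    (leftAdj X).counit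

end Orbifold

open Orbifold BicategoryWithAdjoints

/-! Write Y for the right adjoint of X. Transporting the left adjoint of X along φ gives a second
adjunction Y ⊣ X next to X ⊣ Y, and everything is formal from such a pair. The endomorphism algebra
X ≫ Y takes its algebra structure from X ⊣ Y and its coalgebra structure from Y ⊣ X. The (co)unit
laws are triangle identities; (co)associativity and the Frobenius relations are the interchange law,
since they only slide a cup or a cap past another one.

Multiplication after comultiplication creates a closed loop in the region b between the strands X
and Y, namely the composite 𝟙 b ⟶ Y ≫ X ⟶ 𝟙 b of the unit of Y ⊣ X with the counit of X ⊣ Y. For the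
transported adjunction this loop is the right trace. If the trace is invertible, multiplying the
unit of Y ⊣ X by its inverse and the counit by the trace itself keeps the triangle identities
(`rescaledAdj`) and makes the loop equal to 1, so the algebra becomes separable.

A loop equal to 1 also says that the unit of Y ⊣ X is a section of the counit Y ≫ X ⟶ 𝟙 b. Inserting
this section once more exhibits the counit as a split coequalizer of the two actions
(`counitSplitCoequalizer`), so the relative tensor product exists without any idempotent
completeness.

When idempotents split, X and Y become bimodules between X ≫ Y and the trivial algebra. Over the
trivial algebra their tensor product is the plain composite X ≫ Y, the identity bimodule; over X ≫ Y
it is 𝟙 b by the split coequalizer. These two isomorphisms form the equivalence. -/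

/-- An explicit formula for the factorization of `p` through the split coequalizer: precompose with
the section. It later compares the counit with the projection `pr` onto the chosen relative tensor
product. -/
theorem CategoryTheory.IsSplitCoequalizer.π_rightSection_comp {C : Type*} [Category* C]
    {X Y Z W : C} {f g : X ⟶ Y} {π : Y ⟶ Z} (q : IsSplitCoequalizer f g π) {p : Y ⟶ W}
    (hp : f ≫ p = g ≫ p) : π ≫ q.rightSection ≫ p = p := by
  rw [← q.leftSection_top_assoc, hp, q.leftSection_bottom_assoc]

namespace Orbifold

/-! ### Frobenius algebras from a two-sided adjunction -/

section ambidextrous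

variable {B : Type u} [Bicategory.{w, v} B] {a b : B} {X : a ⟶ b} {Y : b ⟶ a}

/-- Two adjunctions `X ⊣ Y` and `Y ⊣ X` make `X ≫ Y` a Frobenius algebra. -/
def FrobeniusAlgebra.ofAdjunctions (adj : X ⊣ Y) (adj' : Y ⊣ X) : FrobeniusAlgebra (X ≫ Y) where
  mul := (α_ X Y (X ≫ Y)).hom ≫ X ◁ ((α_ Y X Y).inv ≫ adj.counit ▷ Y ≫ (λ_ Y).hom)
  one := adj.unit
  comul := X ◁ ((λ_ Y).inv ≫ adj'.unit ▷ Y ≫ (α_ Y X Y).hom) ≫ (α_ X Y (X ≫ Y)).inv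
  counit := adj'.counit
  -- Each unit law straightens a zigzag of `adj`: on the strand X here, on Y for `mul_one`. The
  -- counit laws below do the same with `adj'`.
  one_mul := by
    calc _ = 𝟙 _ ⊗≫ leftZigzag adj.unit adj.counit ▷ Y ⊗≫ 𝟙 _ := by
          dsimp only [leftZigzag]; bicategory
      _ = _ := by rw [adj.left_triangle]; bicategory
  mul_one := by
    calc _ = 𝟙 _ ⊗≫ X ◁ rightZigzag adj.unit adj.counit ⊗≫ 𝟙 _ := by
          dsimp only [rightZigzag]; bicategory
      _ = _ := by rw [adj.right_triangle]; bicategory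
  mul_assoc := by
    calc _ = 𝟙 _ ⊗≫ X ◁ (adj.counit ▷ (Y ≫ X) ≫ 𝟙 b ◁ adj.counit) ▷ Y ⊗≫ 𝟙 _ := by bicategory
      _ = _ := by rw [← whisker_exchange]; bicategory
  counit_comul := by
    calc _ = 𝟙 _ ⊗≫ rightZigzag adj'.unit adj'.counit ▷ Y ⊗≫ 𝟙 _ := by
          dsimp only [rightZigzag]; bicategory
      _ = _ := by rw [adj'.right_triangle]; bicategory
  comul_counit := by
    calc _ = 𝟙 _ ⊗≫ X ◁ leftZigzag adj'.unit adj'.counit ⊗≫ 𝟙 _ := by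
          dsimp only [leftZigzag]; bicategory
      _ = _ := by rw [adj'.left_triangle]; bicategory
  comul_assoc := by
    calc _ = 𝟙 _ ⊗≫ X ◁ (𝟙 b ◁ adj'.unit ≫ adj'.unit ▷ (Y ≫ X)) ▷ Y ⊗≫ 𝟙 _ := by bicategory
      _ = _ := by rw [whisker_exchange]; bicategory
  -- Creating a pair with `adj'.unit` and contracting a disjoint pair with `adj.counit` commute; no
  -- triangle identity enters.
  frobenius_left := by
    calc _ = 𝟙 _ ⊗≫ X ◁ (adj'.unit ▷ (Y ≫ X) ≫ (Y ≫ X) ◁ adj.counit) ▷ Y ⊗≫ 𝟙 _ := by bicategory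
      _ = _ := by rw [← whisker_exchange]; bicategory
  frobenius_right := by
    calc _ = 𝟙 _ ⊗≫ X ◁ ((Y ≫ X) ◁ adj'.unit ≫ adj.counit ▷ (Y ≫ X)) ▷ Y ⊗≫ 𝟙 _ := by bicategory
      _ = _ := by rw [whisker_exchange]; bicategory

/-- The pair that comultiplication inserts between X and Y is the pair that multiplication
contracts, so the composite is the identity with a closed loop in the middle. -/
theorem FrobeniusAlgebra.isSeparable_ofAdjunctions (adj : X ⊣ Y) (adj' : Y ⊣ X)
    (h : adj'.unit ≫ adj.counit = 𝟙 _) : (ofAdjunctions adj adj').IsSeparable := by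
  calc _ = 𝟙 _ ⊗≫ X ◁ (adj'.unit ≫ adj.counit) ▷ Y ⊗≫ 𝟙 _ := by
        dsimp only [ofAdjunctions]; bicategory
    _ = _ := by rw [h]; bicategory

/-- Replacing the left adjoint of `X` by an isomorphic 1-morphism and rescaling the unit by `s` and
the counit by the inverse `t` of `s` gives again an adjunction. -/
def rescaledAdj {Z : b ⟶ a} (adj : Z ⊣ X) (φ : Z ≅ Y) (s t : 𝟙 b ⟶ 𝟙 b) (hst : s ≫ t = 𝟙 _) :
    Y ⊣ X where
  unit := s ≫ adj.unit ≫ φ.hom ▷ X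
  counit := X ◁ ((λ_ Y).inv ≫ t ▷ Y ≫ (λ_ Y).hom ≫ φ.inv) ≫ adj.counit
  left_triangle := by
    -- ψ is slid upwards past `φ.hom` and `adj.unit`, so that `t` meets `s`. What remains is the
    -- zigzag of `adj` on Z, conjugated by φ.
    set ψ := (λ_ Y).inv ≫ t ▷ Y ≫ (λ_ Y).hom ≫ φ.inv with hψ
    calc _ = 𝟙 _ ⊗≫ s ▷ Y ⊗≫ adj.unit ▷ Y ⊗≫ (φ.hom ▷ (X ≫ Y) ≫ Y ◁ (X ◁ ψ)) ⊗≫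
          Y ◁ adj.counit := by dsimp only [leftZigzag]; bicategory
      _ = 𝟙 _ ⊗≫ s ▷ Y ⊗≫ (adj.unit ▷ Y ≫ (Z ≫ X) ◁ ψ) ⊗≫
          (φ.hom ▷ (X ≫ Z) ≫ Y ◁ adj.counit) := by rw [← whisker_exchange]; bicategory
      _ = 𝟙 _ ⊗≫ (s ≫ t) ▷ Y ⊗≫ φ.inv ⊗≫ leftZigzag adj.unit adj.counit ⊗≫ φ.hom ⊗≫ 𝟙 _ := by
          rw [← whisker_exchange, ← whisker_exchange, hψ]; dsimp only [leftZigzag]; bicategory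
      _ = 𝟙 _ ⊗≫ (φ.inv ≫ φ.hom) ⊗≫ 𝟙 _ := by rw [hst, adj.left_triangle]; bicategory
      _ = _ := by rw [φ.inv_hom_id]; bicategory
  right_triangle := by
    -- Here `t` alone is moved past `φ.hom` and then past `adj.unit`; afterwards `φ.hom` meets
    -- `φ.inv` and `s` meets `t`.
    calc _ = 𝟙 _ ⊗≫ X ◁ s ⊗≫ X ◁ adj.unit ⊗≫ X ◁ (𝟙 b ◁ φ.hom ≫ t ▷ Y) ▷ X ⊗≫
          X ◁ φ.inv ▷ X ⊗≫ adj.counit ▷ X := by dsimp only [rightZigzag]; bicategory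
      _ = 𝟙 _ ⊗≫ X ◁ s ⊗≫ X ◁ (𝟙 b ◁ adj.unit ≫ t ▷ (Z ≫ X)) ⊗≫
          X ◁ (φ.hom ≫ φ.inv) ▷ X ⊗≫ adj.counit ▷ X := by rw [whisker_exchange]; bicategory
      _ = 𝟙 _ ⊗≫ X ◁ (s ≫ t) ⊗≫ rightZigzag adj.unit adj.counit := by
          rw [whisker_exchange, φ.hom_inv_id]; dsimp only [rightZigzag]; bicategory
      _ = _ := by rw [hst, adj.right_triangle]; bicategory

/-- If the composite `𝟙 b ⟶ Y ≫ X ⟶ 𝟙 b` is the identity, then the counit of `X ⊣ Y` is a split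
coequalizer of the two actions of `X ≫ Y` on `Y ≫ X`. -/
def counitSplitCoequalizer (adj : X ⊣ Y) (d : 𝟙 b ⟶ Y ≫ X) (h : d ≫ adj.counit = 𝟙 _) :
    IsSplitCoequalizer (((α_ Y X Y).inv ≫ adj.counit ▷ Y ≫ (λ_ Y).hom) ▷ X)
      ((α_ Y (X ≫ Y) X).hom ≫ Y ◁ ((α_ X Y X).hom ≫ X ◁ adj.counit ≫ (ρ_ X).hom))
      adj.counit where
  rightSection := d
  -- A second pair Y, X is inserted by `d` on the right. The action on X contracts this new pair and
  -- leaves the identity; the action on Y contracts the old pair and leaves the counit followed by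
  -- `d`.
  leftSection := (ρ_ (Y ≫ X)).inv ≫ (Y ≫ X) ◁ d ≫ (α_ Y X (Y ≫ X)).hom ≫
    Y ◁ (α_ X Y X).inv ≫ (α_ Y (X ≫ Y) X).inv
  condition := by
    calc _ = 𝟙 _ ⊗≫ (adj.counit ▷ (Y ≫ X) ≫ 𝟙 b ◁ adj.counit) ⊗≫ 𝟙 _ := by bicategory
      _ = _ := by rw [← whisker_exchange]; bicategory
  rightSection_π := h
  leftSection_bottom := by
    calc _ = 𝟙 _ ⊗≫ (Y ≫ X) ◁ (d ≫ adj.counit) ⊗≫ 𝟙 _ := by bicategory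
      _ = _ := by rw [h]; bicategory
  leftSection_top := by
    calc _ = 𝟙 _ ⊗≫ ((Y ≫ X) ◁ d ≫ adj.counit ▷ (Y ≫ X)) ⊗≫ 𝟙 _ := by bicategory
      _ = _ := by rw [whisker_exchange]; bicategory

/-! ### Recognizing a relative tensor product -/

namespace Bimodule

variable [∀ a b : B, IsIdempotentComplete (a ⟶ b)] {P Q R : EquivariantCompletion B}

/-- The isomorphism out of a relative tensor product induced by a balanced map of bimodules `h`
with a section `j` that is inverse to `h` modulo the intermediate algebra. -/
noncomputable def tensorIso {M : Bimodule P Q} {N : Bimodule Q R} {K : Bimodule P R}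
    (h : M.X ≫ N.X ⟶ K.X) (j : K.X ⟶ M.X ≫ N.X) (hb : Balanced M N h)
    (hl : M.l ▷ N.X ≫ h = (α_ _ _ _).hom ≫ P.alg ◁ h ≫ K.l)
    (hr : M.X ◁ N.r ≫ h = (α_ _ _ _).inv ≫ h ▷ R.alg ≫ K.r)
    (hj : j ≫ h = 𝟙 _) (hp : h ≫ j ≫ pr M N = pr M N) : tensor M N ≅ K :=
  isoMk
    { hom := (desc h hb hl hr).hom
      -- `j` itself need not respect the actions: the inverse of an invertible bimodule map is
      -- automatically a bimodule map.
      inv := j ≫ pr M N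
      hom_inv_id := by
        rw [← cancel_epi (pr M N), reassoc_of% @pr_desc_hom, hp, Category.comp_id]
      inv_hom_id := by rw [Category.assoc, pr_desc_hom, hj] }
    (desc h hb hl hr).l_comm (desc h hb hl hr).r_comm

end Bimodule

open Bimodule

/-! ### X and Y as bimodules -/

variable (adj : X ⊣ Y) (adj' : Y ⊣ X) (h : adj'.unit ≫ adj.counit = 𝟙 _)

/-- The separable Frobenius algebra `X ≫ Y` as an object of the equivariant completion. -/
def EquivariantCompletion.ofAdjunctions : EquivariantCompletion B :=
  ⟨a, X ≫ Y, .ofAdjunctions adj adj', FrobeniusAlgebra.isSeparable_ofAdjunctions adj adj' h⟩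

/-- `X` as a bimodule between `X ≫ Y` and the trivial algebra. -/
def bimoduleToTrivial :
    Bimodule (EquivariantCompletion.ofAdjunctions adj adj' h) (.trivial b) where
  X := X
  l := (α_ X Y X).hom ≫ X ◁ adj.counit ≫ (ρ_ X).hom
  r := (ρ_ X).hom
  -- The module axioms over X ≫ Y use only `adj`: a triangle identity for the unit, interchange of
  -- two counits for the multiplication. Those over the trivial algebra, and the compatibility of
  -- the two actions, are coherence.
  one_l := by
    dsimp only [EquivariantCompletion.ofAdjunctions, FrobeniusAlgebra.ofAdjunctions]
    calc _ = leftZigzag adj.unit adj.counit ⊗≫ 𝟙 _ := by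
          dsimp only [leftZigzag]; bicategory
      _ = _ := by rw [adj.left_triangle]; bicategory
  mul_l := by
    change ((α_ X Y (X ≫ Y)).hom ≫ X ◁ ((α_ Y X Y).inv ≫ adj.counit ▷ Y ≫ (λ_ Y).hom)) ▷ X ≫
        (α_ X Y X).hom ≫ X ◁ adj.counit ≫ (ρ_ X).hom =
      (α_ (X ≫ Y) (X ≫ Y) X).hom ≫ (X ≫ Y) ◁ ((α_ X Y X).hom ≫ X ◁ adj.counit ≫ (ρ_ X).hom) ≫
        (α_ X Y X).hom ≫ X ◁ adj.counit ≫ (ρ_ X).hom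
    calc _ = 𝟙 _ ⊗≫ X ◁ (adj.counit ▷ (Y ≫ X) ≫ 𝟙 b ◁ adj.counit) ⊗≫ 𝟙 _ := by bicategory
      _ = _ := by rw [← whisker_exchange]; bicategory
  r_one := by
    dsimp only [EquivariantCompletion.trivial]; bicategory
  r_mul := by
    dsimp only [EquivariantCompletion.trivial]; bicategory
  middle := by
    dsimp only [EquivariantCompletion.trivial, EquivariantCompletion.ofAdjunctions]; bicategory

/-- `Y` as a bimodule between the trivial algebra and `X ≫ Y`. -/
def bimoduleFromTrivial :
    Bimodule (.trivial b) (EquivariantCompletion.ofAdjunctions adj adj' h) where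
  X := Y
  l := (λ_ Y).hom
  r := (α_ Y X Y).inv ≫ adj.counit ▷ Y ≫ (λ_ Y).hom
  one_l := by
    dsimp only [EquivariantCompletion.trivial]; bicategory
  mul_l := by
    dsimp only [EquivariantCompletion.trivial]; bicategory
  r_one := by
    dsimp only [EquivariantCompletion.ofAdjunctions, FrobeniusAlgebra.ofAdjunctions]
    calc _ = rightZigzag adj.unit adj.counit ⊗≫ 𝟙 _ := by
          dsimp only [rightZigzag]; bicategory
      _ = _ := by rw [adj.right_triangle]; bicategory
  r_mul := by
    change Y ◁ ((α_ X Y (X ≫ Y)).hom ≫ X ◁ ((α_ Y X Y).inv ≫ adj.counit ▷ Y ≫ (λ_ Y).hom)) ≫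
        (α_ Y X Y).inv ≫ adj.counit ▷ Y ≫ (λ_ Y).hom =
      (α_ Y (X ≫ Y) (X ≫ Y)).inv ≫ ((α_ Y X Y).inv ≫ adj.counit ▷ Y ≫ (λ_ Y).hom) ▷ (X ≫ Y) ≫
        (α_ Y X Y).inv ≫ adj.counit ▷ Y ≫ (λ_ Y).hom
    calc _ = 𝟙 _ ⊗≫ ((Y ≫ X) ◁ adj.counit ≫ adj.counit ▷ 𝟙 b) ▷ Y ⊗≫ 𝟙 _ := by bicategory
      _ = _ := by rw [whisker_exchange]; bicategory
  middle := by
    dsimp only [EquivariantCompletion.trivial, EquivariantCompletion.ofAdjunctions]; bicategory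

/-! ### The equivalence with the trivial algebra -/

variable [∀ a b : B, IsIdempotentComplete (a ⟶ b)]

/-- The tensor product of `X` and `Y` over the trivial algebra is `X ≫ Y`. -/
noncomputable def tensorOverTrivialIso :
    tensor (bimoduleToTrivial adj adj' h) (bimoduleFromTrivial adj adj' h) ≅ unit _ :=
  -- Both actions of 𝟙 b are unitors, so balancedness of the identity is the triangle axiom of the
  -- bicategory.
  tensorIso (𝟙 (X ≫ Y)) (𝟙 (X ≫ Y))
    (by
      dsimp only [Bimodule.Balanced, bimoduleToTrivial, bimoduleFromTrivial, EquivariantCompletion.trivial]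
      bicategory)
    (by
      dsimp only [bimoduleToTrivial, bimoduleFromTrivial, EquivariantCompletion.ofAdjunctions,
        FrobeniusAlgebra.ofAdjunctions]
      bicategory)
    (by
      dsimp only [bimoduleToTrivial, bimoduleFromTrivial, EquivariantCompletion.ofAdjunctions,
        FrobeniusAlgebra.ofAdjunctions]
      bicategory)
    (Category.comp_id _) ((Category.id_comp _).trans (Category.id_comp _))

/-- The tensor product of `Y` and `X` over `X ≫ Y` is the identity. -/
noncomputable def tensorOverEndIso :
    tensor (bimoduleFromTrivial adj adj' h) (bimoduleToTrivial adj adj' h) ≅ unit _ :=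
  have hc := (counitSplitCoequalizer adj adj'.unit h).condition
  tensorIso adj.counit adj'.unit
    (hc.trans (Category.assoc _ _ _))
    (by
      dsimp only [bimoduleToTrivial, bimoduleFromTrivial, EquivariantCompletion.trivial]
      bicategory)
    (by
      dsimp only [bimoduleToTrivial, bimoduleFromTrivial, EquivariantCompletion.trivial]
      bicategory)
    h
    -- `pr` coequalizes the two actions, so it factors through the counit by way of the section
    -- `adj'.unit`.
    ((counitSplitCoequalizer adj adj'.unit h).π_rightSection_comp
      (isRelativeTensor_pr (bimoduleFromTrivial adj adj' h) (bimoduleToTrivial adj adj' h)).1)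

/-- If `X ⊣ Y`, `Y ⊣ X` and the composite `𝟙 b ⟶ Y ≫ X ⟶ 𝟙 b` is the identity, then the algebra
`X ≫ Y` is equivalent to the trivial algebra on `b` in the equivariant completion. -/
noncomputable def equivalenceTrivial :
    EquivariantCompletion.ofAdjunctions adj adj' h ≌ EquivariantCompletion.trivial b :=
  -- No compatibility between the two isomorphisms is required: the counit is corrected so as to
  -- satisfy the triangle identities.
  .mkOfAdjointifyCounit (f := bimoduleToTrivial adj adj' h) (g := bimoduleFromTrivial adj adj' h)
    (tensorOverTrivialIso adj adj' h).symm (tensorOverEndIso adj adj' h)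

end ambidextrous

end Orbifold
-- The proposition
theorem proposition4p1 {B : Type u} [Bicategory.{w, v} B] [BicategoryWithAdjoints B]
    {a b : B} (X : a ⟶ b)
    (φ : leftDual X ≅ rightDual X) :
    (∃ F : FrobeniusAlgebra (X ≫ rightDual X),
      F.mul = endMul X ∧
      F.one = (rightAdj X).unit ∧
      F.comul = endComul X φ (𝟙 (𝟙 b)) ∧
      F.counit = endCounit X φ (𝟙 (𝟙 b))) ∧
    (∀ [IsIso (trR X φ.hom)],
      ∃ F : FrobeniusAlgebra (X ≫ rightDual X),
        F.mul = endMul X ∧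
        F.one = (rightAdj X).unit ∧
        F.comul = endComul X φ (inv (trR X φ.hom)) ∧
        F.counit = endCounit X φ (trR X φ.hom) ∧
        ∃ hF : F.IsSeparable,
          IsRelativeTensor (actDual X) (actX X)
            (rightAdj X).counit ∧
          ∀ [∀ c d : B, IsIdempotentComplete (c ⟶ d)],
            Nonempty ((⟨a, X ≫ rightDual X, F, hF⟩ :
              EquivariantCompletion B) ≌ EquivariantCompletion.trivial b)) := by
  refine ⟨⟨.ofAdjunctions (rightAdj X)
    (rescaledAdj (leftAdj X) φ (𝟙 _) (𝟙 _) (Category.comp_id _)), rfl, rfl, rfl, rfl⟩, ?_⟩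
  intro _
  -- The scalars are s = the inverse trace and t = the trace, so that the loop in `h` is the inverse
  -- trace times the trace.
  let adj' := rescaledAdj (leftAdj X) φ _ _ (IsIso.inv_hom_id (trR X φ.hom))
  have h : adj'.unit ≫ (rightAdj X).counit = 𝟙 _ :=
    (by simp [adj', rescaledAdj, trR] : _ = inv (trR X φ.hom) ≫ trR X φ.hom).trans
      (IsIso.inv_hom_id _)
  have hs := counitSplitCoequalizer (rightAdj X) adj'.unit h
  exact ⟨.ofAdjunctions (rightAdj X) adj', rfl, rfl, rfl, rfl,
    FrobeniusAlgebra.isSeparable_ofAdjunctions (rightAdj X) adj' h,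
    ⟨hs.condition, ⟨hs.isCoequalizer⟩⟩, ⟨equivalenceTrivial (rightAdj X) adj' h⟩⟩
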